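/- Theorem. Let $A>0$, $B>0$ and $c$ be real constants, let $t\in(0,\tfrac12)$, and let $a=(a_1,a_2,a_3,a_4)\in\mathbb{R}^4$ satisfy $\sum_{i=1}^4 a_i^2=\frac{2t}{1-2t}$. Let $\mathbb{R}^5_+=\{(x_1,\dots,x_4,z)\in\mathbb{R}^5: z>0\}$ carry the Riemannian metric $$h=(Az+B)^{-2t}\Big(\sum_{i=1}^4 dx_i^2+dz^2\Big).$$ Then $(\mathbb{R}^5_+,h)$ has strictly negative sectional curvature. Let $U=\{x\in\mathbb{R}^4:\sum_{i=1}^4 a_ix_i+c>0\}$ and let $\varphi:U\to\mathbb{R}^5_+$, $\varphi(x)=(x_1,\dots,x_4,\sum_{i=1}^4 a_ix_i+c)$. Then $\varphi$ is a smooth embedding of $U$ onto the part $\{(x,z): z>0,\ z=\sum_i a_ix_i+c\}$ of a hyperplane that lies in $\mathbb{R}^5_+$, and, when $U$ carries the induced metric $\varphi^*h$, it is a proper biharmonic hypersurface: the isometric immersion $\varphi:(U,\varphi^*h)\to(\mathbb{R}^5_+,h)$ is biharmonic, that is, $$\tau^2(\varphi)=\mathrm{Trace}_{\varphi^*h}\big(\nabla^\varphi\nabla^\varphi-\nabla^\varphi_{\nabla^U}\big)\tau(\varphi)-\mathrm{Trace}_{\varphi^*h}R^h(d\varphi,\tau(\varphi))d\varphi=0,\qquad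 \tau(\varphi)=\mathrm{Trace}_{\varphi^*h}\nabla d\varphi,$$ where $R^h(X,Y)Z=\nabla_X\nabla_YZ-\nabla_Y\nabla_XZ-\nabla_{[X,Y]}Z$ is the curvature of $h$; it is not harmonic ($\tau(\varphi)\not\equiv0$); and the hypersurface is not minimal (its mean curvature does not vanish identically). Consequently there are infinitely many counterexamples to the generalized Chen conjecture (every biharmonic submanifold of a Riemannian manifold of nonpositive sectional curvature is minimal): for all fixed $A,B>0$ and $t\in(0,\tfrac12)$, infinitely many of these hypersurfaces (for varying $a$ and $c$) are counterexamples in $(\mathbb{R}^5_+,h)$; and for all fixed $A,B>0$, infinitely many of the metrics $h$ on $\mathbb{R}^5_+$ (for varying $t$) admit such a counterexample. -/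

import Mathlib

open scoped ContDiff Matrix

noncomputable section

/- Riemannian geometry on open subsets of `ℝⁿ`, in the global coordinates.  A metric is given by
its matrix of coefficients `g x i j = g(∂ᵢ, ∂ⱼ)` at the point `x`; it is used only at the points
of a given open set.  Tangent vectors are given by their coordinates. -/
namespace ChartGeom

variable {m n : ℕ}

/-- The partial derivative `∂ᵢ F` at the point `x`. -/
def pd {E : Type*} [NormedAddCommGroup E] [NormedSpace ℝ E] (i : Fin n)
    (F : (Fin n → ℝ) → E) (x : Fin n → ℝ) : E :=
  fderiv ℝ F x (Pi.single i 1)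

/-- `g` is a smooth Riemannian metric on the open set `U`. -/
structure IsRiemannianMetricOn (U : Set (Fin n → ℝ))
    (g : (Fin n → ℝ) → Matrix (Fin n) (Fin n) ℝ) : Prop where
  isOpen : IsOpen U
  smooth : ∀ i j, ContDiffOn ℝ ∞ (fun x => g x i j) U
  posDef : ∀ x ∈ U, (g x).PosDef

/-- The value `g_x(X, Y)` of the metric on two tangent vectors at `x`. -/
def metricInner (g : (Fin n → ℝ) → Matrix (Fin n) (Fin n) ℝ) (x X Y : Fin n → ℝ) : ℝ :=
  ∑ i, ∑ j, g x i j * X i * Y j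

/-- The Christoffel symbol `Γᵏᵢⱼ` of the Levi-Civita connection of `g`. -/
def christoffel (g : (Fin n → ℝ) → Matrix (Fin n) (Fin n) ℝ) (k i j : Fin n)
    (x : Fin n → ℝ) : ℝ :=
  (1 / 2) * ∑ l, (g x)⁻¹ k l *
    (pd i (fun y => g y j l) x + pd j (fun y => g y i l) x - pd l (fun y => g y i j) x)

/-- The coefficient `Rⁱⱼₖₗ` of the curvature tensor, `R(∂ₖ, ∂ₗ) ∂ⱼ = ∑ᵢ Rⁱⱼₖₗ ∂ᵢ`, where
`R(X, Y) Z = ∇_X ∇_Y Z - ∇_Y ∇_X Z - ∇_[X, Y] Z`. -/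
def curvatureCoeff (g : (Fin n → ℝ) → Matrix (Fin n) (Fin n) ℝ) (i j k l : Fin n)
    (x : Fin n → ℝ) : ℝ :=
  pd k (christoffel g i l j) x - pd l (christoffel g i k j) x
    + ∑ p, (christoffel g i k p x * christoffel g p l j x
      - christoffel g i l p x * christoffel g p k j x)

/-- The curvature operator `R(X, Y) Z` on tangent vectors at the point `x`. -/
def curvature (g : (Fin n → ℝ) → Matrix (Fin n) (Fin n) ℝ) (x X Y Z : Fin n → ℝ) :
    Fin n → ℝ :=
  fun i => ∑ j, ∑ k, ∑ l, curvatureCoeff g i j k l x * X k * Y l * Z j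

/-- The sectional curvature at `x` of the plane spanned by the (linearly independent) tangent
vectors `X` and `Y`. -/
def sectionalCurvature (g : (Fin n → ℝ) → Matrix (Fin n) (Fin n) ℝ) (x X Y : Fin n → ℝ) : ℝ :=
  metricInner g x (curvature g x X Y Y) X /
    (metricInner g x X X * metricInner g x Y Y - metricInner g x X Y ^ 2)

/-- All sectional curvatures of `(V, h)` are strictly negative. -/
def HasNegSectionalCurvatureOn (V : Set (Fin n → ℝ))
    (h : (Fin n → ℝ) → Matrix (Fin n) (Fin n) ℝ) : Prop :=
  ∀ p ∈ V, ∀ X Y : Fin n → ℝ, LinearIndependent ℝ ![X, Y] → sectionalCurvature h p X Y < 0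

/-- All sectional curvatures of `(V, h)` are at most zero. -/
def HasNonposSectionalCurvatureOn (V : Set (Fin n → ℝ))
    (h : (Fin n → ℝ) → Matrix (Fin n) (Fin n) ℝ) : Prop :=
  ∀ p ∈ V, ∀ X Y : Fin n → ℝ, LinearIndependent ℝ ![X, Y] → sectionalCurvature h p X Y ≤ 0

/-- The metric `φ^* h` induced by the map `φ`. -/
def inducedMetric (h : (Fin n → ℝ) → Matrix (Fin n) (Fin n) ℝ)
    (φ : (Fin m → ℝ) → (Fin n → ℝ)) : (Fin m → ℝ) → Matrix (Fin m) (Fin m) ℝ :=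
  fun x => Matrix.of fun i j => metricInner h (φ x) (pd i φ x) (pd j φ x)

/-- The covariant derivative `∇^φ_{∂ᵢ} W` of a vector field `W` along the map `φ` (a section of
the bundle `φ^* TN`) in the pulled back Levi-Civita connection of `h`. -/
def covDerivAlong (h : (Fin n → ℝ) → Matrix (Fin n) (Fin n) ℝ)
    (φ : (Fin m → ℝ) → (Fin n → ℝ)) (i : Fin m) (W : (Fin m → ℝ) → (Fin n → ℝ)) :
    (Fin m → ℝ) → (Fin n → ℝ) :=
  fun x α => pd i W x α + ∑ β, ∑ γ, christoffel h α β γ (φ x) * pd i φ x β * W x γ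

/-- The tension field `τ(φ) = Trace_g ∇dφ` of a map `φ : (U, g) → (V, h)`. -/
def tension (g : (Fin m → ℝ) → Matrix (Fin m) (Fin m) ℝ)
    (h : (Fin n → ℝ) → Matrix (Fin n) (Fin n) ℝ) (φ : (Fin m → ℝ) → (Fin n → ℝ)) :
    (Fin m → ℝ) → (Fin n → ℝ) :=
  fun x => ∑ i, ∑ j, (g x)⁻¹ i j •
    (covDerivAlong h φ i (pd j φ) x - ∑ k, christoffel g k i j x • pd k φ x)

/-- The bitension field
`τ²(φ) = Trace_g (∇^φ ∇^φ - ∇^φ_{∇^M}) τ(φ) - Trace_g R^N(dφ, τ(φ)) dφ`. -/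
def bitension (g : (Fin m → ℝ) → Matrix (Fin m) (Fin m) ℝ)
    (h : (Fin n → ℝ) → Matrix (Fin n) (Fin n) ℝ) (φ : (Fin m → ℝ) → (Fin n → ℝ)) :
    (Fin m → ℝ) → (Fin n → ℝ) :=
  fun x => ∑ i, ∑ j, (g x)⁻¹ i j •
    (covDerivAlong h φ i (covDerivAlong h φ j (tension g h φ)) x
      - ∑ k, christoffel g k i j x • covDerivAlong h φ k (tension g h φ) x
      - curvature h (φ x) (pd i φ x) (tension g h φ x) (pd j φ x))

/-- `φ : (U, g) → (V, h)` is harmonic. -/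
def IsHarmonicOn (U : Set (Fin m → ℝ)) (g : (Fin m → ℝ) → Matrix (Fin m) (Fin m) ℝ)
    (h : (Fin n → ℝ) → Matrix (Fin n) (Fin n) ℝ) (φ : (Fin m → ℝ) → (Fin n → ℝ)) : Prop :=
  ∀ x ∈ U, tension g h φ x = 0

/-- `φ : (U, g) → (V, h)` is biharmonic. -/
def IsBiharmonicOn (U : Set (Fin m → ℝ)) (g : (Fin m → ℝ) → Matrix (Fin m) (Fin m) ℝ)
    (h : (Fin n → ℝ) → Matrix (Fin n) (Fin n) ℝ) (φ : (Fin m → ℝ) → (Fin n → ℝ)) : Prop :=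
  ∀ x ∈ U, bitension g h φ x = 0

/-- `φ`, on the open set `U`, is a smooth embedding with values in `V`: it parametrizes the
embedded submanifold `φ(U)` of `V`, whose dimension is that of the source. -/
structure ParametrizesSubmanifold (U : Set (Fin m → ℝ)) (V : Set (Fin n → ℝ))
    (φ : (Fin m → ℝ) → (Fin n → ℝ)) : Prop where
  isOpen : IsOpen U
  mapsTo : Set.MapsTo φ U V
  smooth : ContDiffOn ℝ ∞ φ U
  immersion : ∀ x ∈ U, Function.Injective (fderiv ℝ φ x)
  embedding : Topology.IsEmbedding (U.domRestrict φ)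

/-- The submanifold of `(V, h)` parametrized by `φ` on `U` is minimal: its mean curvature vanishes
in every normal direction `ν`.  Here `h(∇^φ_{∂ᵢ} ∂ⱼφ, ν)` are the coefficients of the second
fundamental form in the direction `ν`, and their trace for the induced metric is taken. -/
def IsMinimalOn (U : Set (Fin m → ℝ)) (h : (Fin n → ℝ) → Matrix (Fin n) (Fin n) ℝ)
    (φ : (Fin m → ℝ) → (Fin n → ℝ)) : Prop :=
  ∀ x ∈ U, ∀ ν : Fin n → ℝ, (∀ k, metricInner h (φ x) (pd k φ x) ν = 0) →
    ∑ i, ∑ j, (inducedMetric h φ x)⁻¹ i j *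
      metricInner h (φ x) (covDerivAlong h φ i (pd j φ) x) ν = 0

/-- `φ` on `U` parametrizes a proper biharmonic submanifold of `(V, h)`: with the induced metric
on `U`, it is biharmonic, and it is not minimal. -/
structure IsProperBiharmonicSubmanifold (U : Set (Fin m → ℝ)) (V : Set (Fin n → ℝ))
    (h : (Fin n → ℝ) → Matrix (Fin n) (Fin n) ℝ) (φ : (Fin m → ℝ) → (Fin n → ℝ)) : Prop where
  submanifold : ParametrizesSubmanifold U V φ
  biharmonic : IsBiharmonicOn U (inducedMetric h φ) h φ
  not_minimal : ¬ IsMinimalOn U h φ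

/-- A counterexample to the generalized Chen conjecture (any biharmonic submanifold of a Riemannian
manifold of nonpositive sectional curvature is minimal): the Riemannian manifold is `(V, h)`, the
submanifold is the one parametrized by `φ` on `U`. -/
structure IsChenCounterexample (U : Set (Fin m → ℝ)) (V : Set (Fin n → ℝ))
    (h : (Fin n → ℝ) → Matrix (Fin n) (Fin n) ℝ) (φ : (Fin m → ℝ) → (Fin n → ℝ)) : Prop where
  metric : IsRiemannianMetricOn V h
  nonpos : HasNonposSectionalCurvatureOn V h
  proper_biharmonic : IsProperBiharmonicSubmanifold U V h φ

/-- The upper half space `ℝ⁵₊` of points `(x₁, …, x₄, z)` with `z > 0`. -/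
def upperHalfSpace5 : Set (Fin 5 → ℝ) := {p | 0 < p (Fin.last 4)}

/-- The metric `(A z + B)^(-2t) (∑ dxᵢ² + dz²)`. -/
def conformalMetric (A B t : ℝ) : (Fin 5 → ℝ) → Matrix (Fin 5) (Fin 5) ℝ :=
  fun p => (A * p (Fin.last 4) + B) ^ (-2 * t) • (1 : Matrix (Fin 5) (Fin 5) ℝ)

/-- The map `x ↦ (x₁, …, x₄, ∑ aᵢ xᵢ + c)`. -/
def hyperplaneMap (a : Fin 4 → ℝ) (c : ℝ) : (Fin 4 → ℝ) → (Fin 5 → ℝ) :=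
  fun x => Fin.snoc (α := fun _ => ℝ) x (∑ i, a i * x i + c)

/-- The set of those `x` for which `(x₁, …, x₄, ∑ aᵢ xᵢ + c)` lies in the upper half space. -/
def hyperplaneDomain (a : Fin 4 → ℝ) (c : ℝ) : Set (Fin 4 → ℝ) := {x | 0 < ∑ i, a i * x i + c}

/-- The part in the upper half space of the hyperplane `z = ∑ aᵢ xᵢ + c`. -/
def hyperplane (a : Fin 4 → ℝ) (c : ℝ) : Set (Fin 5 → ℝ) :=
  {p | p ∈ upperHalfSpace5 ∧ p (Fin.last 4) = ∑ i : Fin 4, a i * p i.castSucc + c}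

end ChartGeom

end

/-! Write $u=Az+B$. The Christoffel form of $h$ is $-tA\,u^{-1}S$ with $S(X,Y)=X_5Y+Y_5X-\langle
X,Y\rangle e_5$ constant, so its curvature is $A^2u^{-2}$ times an algebraic expression in $S$. This
gives $\langle R(X,Y)Y,X\rangle$ as a negative multiple of $t^2(|X|^2|Y|^2-\langle
X,Y\rangle^2)+t(1-t)|Y_5X-X_5Y|^2$.

On the hyperplane, let $X_i$ be the coordinate tangent vectors, $N=(a,-1)$ the Euclidean normal and
$G=I+aa^{T}$ the Euclidean Gram matrix. The induced metric $u^{-2t}G$ has the same shape as $h$, and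
a field $u^rV$ with $V$ constant has covariant derivative $u^{r-1}A(ra_iV-tS(X_i,V))$. Hence
everything needed is a power of $u$ times linear algebra, with traces taken by $G^{-1}$. The tension
field is $-4tA(1+|a|^2)^{-1}u^{2t-1}N$, which is never zero. In the bitension field the $e_5$ terms
cancel identically, and the coefficient of $N$ is a multiple of $(1+t)\big(|a|^2(1-2t)-2t\big)$:
this is the hypothesis on $|a|^2$.

The carrying lemmas are `christoffel_affineConformalMetric`, `curvature_conformalMetric`,
`covDerivAlong_hyperplaneMap`, `trace_hyperplaneGramInv` and `bitension_hyperplaneMap_eq_zero`. The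
infinite families come from varying $c$, and from varying $t$. -/

noncomputable section

namespace ChartGeom

variable {n : ℕ}

/-! ### Christoffel symbols of a constant metric rescaled by a power of an affine function. -/

/-- The metric `(A (b ⬝ x + c) + B)^(-2t) G`, conformal to the constant metric `G`. -/
def affineConformalMetric (A B t : ℝ) (b : Fin n → ℝ) (c : ℝ) (G : Matrix (Fin n) (Fin n) ℝ) :
    (Fin n → ℝ) → Matrix (Fin n) (Fin n) ℝ :=
  fun x => (A * (b ⬝ᵥ x + c) + B) ^ (-2 * t) • G

theorem hasFDerivAt_dotProduct (b x : Fin n → ℝ) :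
    HasFDerivAt (fun y => b ⬝ᵥ y)
      (LinearMap.toContinuousLinearMap (dotProductBilin ℝ ℝ b : (Fin n → ℝ) →ₗ[ℝ] ℝ)) x :=
  (LinearMap.toContinuousLinearMap (dotProductBilin ℝ ℝ b : (Fin n → ℝ) →ₗ[ℝ] ℝ)).hasFDerivAt

theorem hasFDerivAt_affine_rpow_smul {E : Type*} [NormedAddCommGroup E] [NormedSpace ℝ E]
    (A B c r : ℝ) (b x : Fin n → ℝ) (V : E) (hx : 0 < A * (b ⬝ᵥ x + c) + B) :
    HasFDerivAt (fun y : Fin n → ℝ => (A * (b ⬝ᵥ y + c) + B) ^ r • V)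
      (((r * (A * (b ⬝ᵥ x + c) + B) ^ (r - 1)) • A •
        LinearMap.toContinuousLinearMap (dotProductBilin ℝ ℝ b : (Fin n → ℝ) →ₗ[ℝ] ℝ)).smulRight V)
      x :=
  (((((hasFDerivAt_dotProduct b x).add_const c).const_mul A).add_const B).rpow_const
    (Or.inl hx.ne')).smul_const V

theorem pd_affine_rpow_smul {E : Type*} [NormedAddCommGroup E] [NormedSpace ℝ E]
    (A B c r : ℝ) (b x : Fin n → ℝ) (V : E) (hx : 0 < A * (b ⬝ᵥ x + c) + B) (i : Fin n) :
    pd i (fun y : Fin n → ℝ => (A * (b ⬝ᵥ y + c) + B) ^ r • V) x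
      = (r * (A * (b ⬝ᵥ x + c) + B) ^ (r - 1) * (A * b i)) • V := by
  rw [pd, (hasFDerivAt_affine_rpow_smul A B c r b x V hx).fderiv]
  simp [dotProductBilin]

theorem pd_congr {E : Type*} [NormedAddCommGroup E] [NormedSpace ℝ E]
    {F F' : (Fin n → ℝ) → E} {x : Fin n → ℝ} (h : F =ᶠ[nhds x] F') (i : Fin n) :
    pd i F x = pd i F' x := by
  rw [pd, pd, h.fderiv_eq]

theorem isOpen_affine_pos (A B c : ℝ) (b : Fin n → ℝ) :
    IsOpen {x : Fin n → ℝ | 0 < A * (b ⬝ᵥ x + c) + B} :=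
  isOpen_lt continuous_const (by unfold dotProduct; fun_prop)

/-- Each derivative $\partial_i g_{pq}$ is $-2tA\,b_i\,u^{-2t-1}G_{pq}$, and the inverse metric
$u^{2t}G'$ cancels all but $u^{-1}$. The lemma serves both the half space ($G=1$, $b=e_5$) and the
hyperplane ($G=I+aa^{T}$, $b=a$). -/
theorem christoffel_affineConformalMetric (A B t : ℝ) (b : Fin n → ℝ) (c : ℝ)
    (G G' : Matrix (Fin n) (Fin n) ℝ) (hG : G.IsSymm) (hGG' : G * G' = 1)
    (x : Fin n → ℝ) (hx : 0 < A * (b ⬝ᵥ x + c) + B) (k i j : Fin n) :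
    christoffel (affineConformalMetric A B t b c G) k i j x =
      (A * (b ⬝ᵥ x + c) + B) ^ (-1 : ℝ) * (-t * A *
        ((if k = j then b i else 0) + (if k = i then b j else 0) - (G' *ᵥ b) k * G i j)) := by
  have hpd (i p q : Fin n) : pd i (fun y => affineConformalMetric A B t b c G y p q) x =
      (-2 * t * (A * (b ⬝ᵥ x + c) + B) ^ (-2 * t - 1) * (A * b i)) * G p q :=
    pd_affine_rpow_smul A B c (-2 * t) b x (G p q) hx i
  have hG'G : G' * G = 1 := mul_eq_one_comm.mp hGG'
  have hinv : (affineConformalMetric A B t b c G x)⁻¹ =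
      (A * (b ⬝ᵥ x + c) + B) ^ (2 * t) • G' := by
    apply Matrix.inv_eq_right_inv
    rw [affineConformalMetric, Matrix.smul_mul, Matrix.mul_smul, hGG', smul_smul,
      ← Real.rpow_add hx]
    simp
  have h1 (p q : Fin n) : ∑ l, G' p l * G q l = if p = q then 1 else 0 := by
    have := congrFun (congrFun hG'G p) q
    rw [Matrix.mul_apply, Matrix.one_apply] at this
    rw [← this]
    exact Finset.sum_congr rfl fun l _ => by rw [hG.apply]
  have hpow : (A * (b ⬝ᵥ x + c) + B) ^ (2 * t) * (A * (b ⬝ᵥ x + c) + B) ^ (-2 * t - 1) =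
      (A * (b ⬝ᵥ x + c) + B) ^ (-1 : ℝ) := by
    rw [← Real.rpow_add hx]; congr 1; ring
  rw [christoffel, hinv]
  simp only [hpd, Matrix.smul_apply, smul_eq_mul]
  rw [← hpow]
  have h2 : (G' *ᵥ b) k = ∑ l, G' k l * b l := rfl
  have h3 : (if k = j then b i else 0) = b i * ∑ l, G' k l * G j l := by
    rw [h1]; simp
  have h4 : (if k = i then b j else 0) = b j * ∑ l, G' k l * G i l := by
    rw [h1]; simp
  rw [h2, h3, h4]
  simp only [Finset.mul_sum, Finset.sum_mul, ← Finset.sum_add_distrib, ← Finset.sum_sub_distrib]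
  exact Finset.sum_congr rfl fun l _ => by ring

/-! ### Connection and curvature of the half space. -/

theorem conformalMetric_eq (A B t : ℝ) : conformalMetric A B t =
    affineConformalMetric A B t (Pi.single (Fin.last 4) 1) 0 1 := by
  ext p; simp [conformalMetric, affineConformalMetric]

/-- The bilinear form `(X, Y) ↦ X₅ Y + Y₅ X - ⟨X, Y⟩ e₅`, to which the Christoffel symbols of the
conformal metric on the half space are proportional. -/
def halfSpaceForm (X Y : Fin 5 → ℝ) : Fin 5 → ℝ :=
  X (Fin.last 4) • Y + Y (Fin.last 4) • X - (X ⬝ᵥ Y) • Pi.single (Fin.last 4) 1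

/-- The coefficients of `halfSpaceForm`. -/
def halfSpaceCoeff (k i j : Fin 5) : ℝ :=
  (if k = j then (if i = Fin.last 4 then 1 else 0) else 0)
    + (if k = i then (if j = Fin.last 4 then 1 else 0) else 0)
    - (if k = Fin.last 4 then (if i = j then 1 else 0) else 0)

theorem sum_halfSpaceCoeff (k : Fin 5) (X Y : Fin 5 → ℝ) :
    ∑ i, ∑ j, halfSpaceCoeff k i j * X i * Y j = halfSpaceForm X Y k := by
  simp [halfSpaceCoeff, halfSpaceForm, add_mul, sub_mul, Finset.sum_add_distrib, ite_mul,
    Finset.sum_sub_distrib, Pi.single_apply, dotProduct]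
  ring

theorem christoffel_conformalMetric (A B t : ℝ) (p : Fin 5 → ℝ)
    (hp : 0 < A * p (Fin.last 4) + B) (k i j : Fin 5) :
    christoffel (conformalMetric A B t) k i j p =
      (A * p (Fin.last 4) + B) ^ (-1 : ℝ) * (-t * A * halfSpaceCoeff k i j) := by
  rw [conformalMetric_eq, christoffel_affineConformalMetric A B t _ 0 1 1 Matrix.isSymm_one
    (one_mul 1) p (by simpa using hp)]
  simp only [halfSpaceCoeff, Matrix.one_mulVec, Pi.single_apply, Matrix.one_apply,
    single_one_dotProduct, add_zero, mul_ite, mul_one, mul_zero]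
  congr 3
  split_ifs <;> rfl

/-- The $t$ term comes from differentiating the factor $-tAu^{-1}$, which depends on the last
coordinate only; the $t^2$ term comes from the products of Christoffel symbols. -/
theorem curvature_conformalMetric (A B t : ℝ) (p : Fin 5 → ℝ)
    (hp : 0 < A * p (Fin.last 4) + B) (X Y Z : Fin 5 → ℝ) :
    curvature (conformalMetric A B t) p X Y Z = (A * p (Fin.last 4) + B) ^ (-2 : ℝ) • A ^ 2 •
      (t • (X (Fin.last 4) • halfSpaceForm Y Z - Y (Fin.last 4) • halfSpaceForm X Z)
        + t ^ 2 • (halfSpaceForm X (halfSpaceForm Y Z) - halfSpaceForm Y (halfSpaceForm X Z))) := by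
  have hev : ∀ᶠ q in nhds p, 0 < A * q (Fin.last 4) + B :=
    (isOpen_lt continuous_const (by fun_prop)).mem_nhds hp
  have hpd (i j k l : Fin 5) : pd k (christoffel (conformalMetric A B t) i l j) p =
      (A * p (Fin.last 4) + B) ^ (-2 : ℝ) * (A ^ 2 * (t *
        ((if k = Fin.last 4 then 1 else 0) * halfSpaceCoeff i l j))) := by
    have h1 : christoffel (conformalMetric A B t) i l j =ᶠ[nhds p]
        fun q => (A * (Pi.single (Fin.last 4) 1 ⬝ᵥ q + 0) + B) ^ (-1 : ℝ) •
          (-t * A * halfSpaceCoeff i l j) := by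
      filter_upwards [hev] with q hq
      rw [christoffel_conformalMetric A B t q hq]; simp
    rw [pd_congr h1, pd_affine_rpow_smul _ _ _ _ _ _ _ (by simpa using hp)]
    simp only [single_one_dotProduct, add_zero, Pi.single_apply, smul_eq_mul]
    rw [show (-1 - 1 : ℝ) = -2 by norm_num]
    generalize (A * p (Fin.last 4) + B) ^ (-2 : ℝ) = u
    split_ifs <;> ring
  have hsq : (A * p (Fin.last 4) + B) ^ (-1 : ℝ) * (A * p (Fin.last 4) + B) ^ (-1 : ℝ) =
      (A * p (Fin.last 4) + B) ^ (-2 : ℝ) := by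
    rw [← Real.rpow_add hp]; norm_num
  have hcoeff (i j k l : Fin 5) : curvatureCoeff (conformalMetric A B t) i j k l p =
      (A * p (Fin.last 4) + B) ^ (-2 : ℝ) * (A ^ 2 * (t *
        ((if k = Fin.last 4 then 1 else 0) * halfSpaceCoeff i l j
          - (if l = Fin.last 4 then 1 else 0) * halfSpaceCoeff i k j)
        + t ^ 2 * (∑ q, halfSpaceCoeff i k q * halfSpaceCoeff q l j
          - ∑ q, halfSpaceCoeff i l q * halfSpaceCoeff q k j))) := by
    rw [curvatureCoeff, hpd, hpd]
    simp only [christoffel_conformalMetric A B t p hp]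
    rw [← hsq]
    generalize (A * p (Fin.last 4) + B) ^ (-1 : ℝ) = u
    simp only [mul_add, mul_sub, Finset.mul_sum, Finset.sum_sub_distrib]
    have h (a b c d e f : Fin 5) : u * (-t * A * halfSpaceCoeff a b c) *
        (u * (-t * A * halfSpaceCoeff d e f)) = u * u * (A ^ 2 * (t ^ 2 *
          (halfSpaceCoeff a b c * halfSpaceCoeff d e f))) := by ring
    simp only [h]
  have hlin (i : Fin 5) (X Y Z : Fin 5 → ℝ) :
      ∑ j, ∑ k, ∑ l, (if k = Fin.last 4 then 1 else 0) * halfSpaceCoeff i l j * X k * Y l * Z j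
        = X (Fin.last 4) * halfSpaceForm Y Z i := by
    conv_rhs => rw [← sum_halfSpaceCoeff, Finset.sum_comm, Finset.mul_sum]
    refine Finset.sum_congr rfl fun j _ => ?_
    rw [Finset.sum_eq_single (Fin.last 4) (by
      intro k _ hk; simp only [if_neg hk, zero_mul, Finset.sum_const_zero]) (by simp), Finset.mul_sum]
    exact Finset.sum_congr rfl fun l _ => by simp; ring
  -- Contracting the product of coefficients composes the bilinear form with itself.
  have hquad (i : Fin 5) (X Y Z : Fin 5 → ℝ) :
      ∑ j, ∑ k, ∑ l, (∑ q, halfSpaceCoeff i k q * halfSpaceCoeff q l j) * X k * Y l * Z j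
        = halfSpaceForm X (halfSpaceForm Y Z) i := by
    rw [← sum_halfSpaceCoeff]
    simp only [← sum_halfSpaceCoeff _ Y Z, Finset.mul_sum, Finset.sum_mul]
    rw [Finset.sum_comm]
    refine Finset.sum_congr rfl fun k _ => ?_
    conv_rhs => rw [Finset.sum_comm]
    rw [Finset.sum_comm]
    refine Finset.sum_congr rfl fun l _ => ?_
    rw [Finset.sum_comm]
    exact Finset.sum_congr rfl fun q _ => Finset.sum_congr rfl fun j _ => by ring
  -- The subtracted terms of the curvature are the others with $X$ and $Y$ exchanged.
  have hswap (i : Fin 5) (F : Fin 5 → Fin 5 → Fin 5 → ℝ) (X Y Z : Fin 5 → ℝ) :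
      ∑ j, ∑ k, ∑ l, F j l k * X k * Y l * Z j = ∑ j, ∑ k, ∑ l, F j k l * Y k * X l * Z j := by
    refine Finset.sum_congr rfl fun j _ => ?_
    rw [Finset.sum_comm]
    exact Finset.sum_congr rfl fun k _ => Finset.sum_congr rfl fun l _ => by ring
  have hcombine (u v : ℝ) (F₁ F₂ F₃ F₄ : Fin 5 → Fin 5 → Fin 5 → ℝ) :
      ∑ j, ∑ k, ∑ l, u * (A ^ 2 * (t * (F₁ j k l - F₂ j k l) + v * (F₃ j k l - F₄ j k l)))
          * X k * Y l * Z j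
        = u * (A ^ 2 * (t * (∑ j, ∑ k, ∑ l, F₁ j k l * X k * Y l * Z j
            - ∑ j, ∑ k, ∑ l, F₂ j k l * X k * Y l * Z j)
          + v * (∑ j, ∑ k, ∑ l, F₃ j k l * X k * Y l * Z j
            - ∑ j, ∑ k, ∑ l, F₄ j k l * X k * Y l * Z j))) := by
    simp only [Finset.mul_sum, ← Finset.sum_sub_distrib, ← Finset.sum_add_distrib]
    exact Finset.sum_congr rfl fun j _ => Finset.sum_congr rfl fun k _ =>
      Finset.sum_congr rfl fun l _ => by ring
  ext i
  simp only [curvature, hcoeff, Pi.smul_apply, Pi.add_apply, Pi.sub_apply, smul_eq_mul]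
  rw [← hlin i X, ← hlin i Y, ← hquad i X, ← hquad i Y]
  rw [← hswap i (fun j l k => (if l = Fin.last 4 then 1 else 0) * halfSpaceCoeff i k j) X Y Z,
    ← hswap i (fun j l k => ∑ q, halfSpaceCoeff i l q * halfSpaceCoeff q k j) X Y Z]
  exact hcombine _ _ (fun j k l => (if k = Fin.last 4 then 1 else 0) * halfSpaceCoeff i l j)
    (fun j k l => (if l = Fin.last 4 then 1 else 0) * halfSpaceCoeff i k j)
    (fun j k l => ∑ q, halfSpaceCoeff i k q * halfSpaceCoeff q l j)
    (fun j k l => ∑ q, halfSpaceCoeff i l q * halfSpaceCoeff q k j)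

theorem halfSpaceForm_apply_last (X Y : Fin 5 → ℝ) : halfSpaceForm X Y (Fin.last 4) =
    2 * X (Fin.last 4) * Y (Fin.last 4) - X ⬝ᵥ Y := by
  simp [halfSpaceForm]; ring

theorem halfSpaceForm_dotProduct (X Y Z : Fin 5 → ℝ) : halfSpaceForm X Y ⬝ᵥ Z =
    X (Fin.last 4) * (Y ⬝ᵥ Z) + Y (Fin.last 4) * (X ⬝ᵥ Z) - (X ⬝ᵥ Y) * Z (Fin.last 4) := by
  simp [halfSpaceForm]

/-! ### Negative sectional curvature. -/

theorem metricInner_conformalMetric (A B t : ℝ) (p X Y : Fin 5 → ℝ) :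
    metricInner (conformalMetric A B t) p X Y =
      (A * p (Fin.last 4) + B) ^ (-2 * t) * (X ⬝ᵥ Y) := by
  simp [metricInner, conformalMetric, Matrix.one_apply, dotProduct, Finset.mul_sum, mul_assoc]

theorem gram_pos {X Y : Fin n → ℝ} (h : LinearIndependent ℝ ![X, Y]) :
    0 < (X ⬝ᵥ X) * (Y ⬝ᵥ Y) - (X ⬝ᵥ Y) ^ 2 := by
  rw [LinearIndependent.pair_iff] at h
  have hpos {Z : Fin n → ℝ} (hZ : Z ≠ 0) : 0 < Z ⬝ᵥ Z := by
    have := Matrix.dotProduct_star_self_pos_iff.mpr hZ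
    simpa using this
  have hY : 0 < Y ⬝ᵥ Y := hpos fun h0 => by simpa using h 0 1 (by simp [h0])
  -- This vector is $|Y|^2$ times the component of $X$ orthogonal to $Y$; its squared length is
  -- $|Y|^2$ times the Gram determinant.
  have hW : 0 < ((Y ⬝ᵥ Y) • X + (-(X ⬝ᵥ Y)) • Y) ⬝ᵥ ((Y ⬝ᵥ Y) • X + (-(X ⬝ᵥ Y)) • Y) :=
    hpos fun h0 => hY.ne' (h _ _ h0).1
  have : ((Y ⬝ᵥ Y) • X + (-(X ⬝ᵥ Y)) • Y) ⬝ᵥ ((Y ⬝ᵥ Y) • X + (-(X ⬝ᵥ Y)) • Y) =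
      (Y ⬝ᵥ Y) * ((X ⬝ᵥ X) * (Y ⬝ᵥ Y) - (X ⬝ᵥ Y) ^ 2) := by
    simp only [add_dotProduct, dotProduct_add, smul_dotProduct, dotProduct_smul, smul_eq_mul,
      dotProduct_comm Y X]
    ring
  rw [this] at hW
  exact pos_of_mul_pos_right hW hY.le

theorem affine_pos_of_mem {A B : ℝ} (hA : 0 < A) (hB : 0 < B) {p : Fin 5 → ℝ}
    (hp : p ∈ upperHalfSpace5) : 0 < A * p (Fin.last 4) + B :=
  add_pos (mul_pos hA hp) hB

theorem hasNegSectionalCurvatureOn_conformalMetric {A B t : ℝ} (hA : 0 < A) (hB : 0 < B)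
    (ht : 0 < t) (ht1 : t < 1) :
    HasNegSectionalCurvatureOn upperHalfSpace5 (conformalMetric A B t) := by
  intro p hp X Y hXY
  have hu := affine_pos_of_mem hA hB hp
  have hg := gram_pos hXY
  have hs : 0 ≤ (Y (Fin.last 4) • X - X (Fin.last 4) • Y) ⬝ᵥ
      (Y (Fin.last 4) • X - X (Fin.last 4) • Y) := by
    simpa using dotProduct_star_self_nonneg (Y (Fin.last 4) • X - X (Fin.last 4) • Y)
  simp only [sub_dotProduct, dotProduct_sub, smul_dotProduct, dotProduct_smul, smul_eq_mul,
      dotProduct_comm Y X] at hs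
  rw [sectionalCurvature]
  simp only [metricInner_conformalMetric, curvature_conformalMetric A B t p hu, smul_dotProduct,
    add_dotProduct, sub_dotProduct, halfSpaceForm_dotProduct, halfSpaceForm_apply_last, smul_eq_mul,
    dotProduct_comm Y (halfSpaceForm _ _), dotProduct_comm X (halfSpaceForm _ _),
    dotProduct_comm Y X]
  have h1 := Real.rpow_pos_of_pos hu (-2 * t)
  have h2 := Real.rpow_pos_of_pos hu (-2)
  generalize (A * p (Fin.last 4) + B) ^ (-2 * t) = v at *
  generalize (A * p (Fin.last 4) + B) ^ (-2 : ℝ) = w at *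
  generalize X ⬝ᵥ X = a at *
  generalize X ⬝ᵥ Y = b at *
  generalize Y ⬝ᵥ Y = d at *
  generalize X (Fin.last 4) = x at *
  generalize Y (Fin.last 4) = y at *
  apply div_neg_of_neg_of_pos
  -- The numerator is the negative of this quantity; the last bracket is $|Y_5X-X_5Y|^2$.
  · have hK : 0 < v * w * A ^ 2 * (t ^ 2 * (a * d - b ^ 2)
        + t * (1 - t) * (y * (y * a) - x * (y * b) - (y * (x * b) - x * (x * d)))) := by
      have := mul_nonneg (mul_pos ht (sub_pos.mpr ht1)).le
        (show 0 ≤ y * (y * a) - x * (y * b) - (y * (x * b) - x * (x * d)) by linarith)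
      have := mul_pos (pow_pos ht 2) hg
      positivity
    linarith
  · have := mul_pos (mul_pos h1 h1) hg
    linarith

theorem isRiemannianMetricOn_conformalMetric {A B : ℝ} (hA : 0 < A) (hB : 0 < B) (t : ℝ) :
    IsRiemannianMetricOn upperHalfSpace5 (conformalMetric A B t) where
  isOpen := isOpen_lt continuous_const (by fun_prop)
  smooth i j := by
    simp only [conformalMetric, Matrix.smul_apply, smul_eq_mul]
    refine ContDiffOn.mul (ContDiffOn.rpow_const_of_ne ?_ ?_) contDiffOn_const
    · exact ContDiff.contDiffOn (by fun_prop)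
    · exact fun p hp => (affine_pos_of_mem hA hB hp).ne'
  posDef p hp := Matrix.PosDef.one.smul (Real.rpow_pos_of_pos (affine_pos_of_mem hA hB hp) _)

/-! ### Euclidean geometry of the hyperplane: tangent vectors, normal, Gram matrix. -/

/-- The linear part of `hyperplaneMap`. -/
def hyperplaneLinear (a : Fin 4 → ℝ) : (Fin 4 → ℝ) →L[ℝ] (Fin 5 → ℝ) :=
  LinearMap.toContinuousLinearMap
    { toFun := fun x => Fin.snoc (α := fun _ => ℝ) x (a ⬝ᵥ x)
      map_add' := fun x y => by
        ext k
        refine Fin.lastCases ?_ (fun k => ?_) k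
        · simp only [Pi.add_apply, Fin.snoc_last, dotProduct_add]
        · simp
      map_smul' := fun r x => by
        ext k
        refine Fin.lastCases ?_ (fun k => ?_) k
        · simp only [Pi.smul_apply, Fin.snoc_last, dotProduct_smul, RingHom.id_apply]
        · simp }

@[simp] theorem hyperplaneLinear_castSucc (a x : Fin 4 → ℝ) (k : Fin 4) :
    hyperplaneLinear a x k.castSucc = x k :=
  Fin.snoc_castSucc (α := fun _ => ℝ) ..

@[simp] theorem hyperplaneLinear_last (a x : Fin 4 → ℝ) :
    hyperplaneLinear a x (Fin.last 4) = a ⬝ᵥ x :=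
  Fin.snoc_last (α := fun _ : Fin 5 => ℝ) (a ⬝ᵥ x) x

@[simp] theorem hyperplaneMap_castSucc (a x : Fin 4 → ℝ) (c : ℝ) (k : Fin 4) :
    hyperplaneMap a c x k.castSucc = x k :=
  Fin.snoc_castSucc (α := fun _ => ℝ) ..

@[simp] theorem hyperplaneMap_last (a x : Fin 4 → ℝ) (c : ℝ) :
    hyperplaneMap a c x (Fin.last 4) = a ⬝ᵥ x + c :=
  Fin.snoc_last (α := fun _ => ℝ) ..

theorem hyperplaneMap_eq (a : Fin 4 → ℝ) (c : ℝ) :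
    hyperplaneMap a c = fun x => hyperplaneLinear a x + Pi.single (Fin.last 4) c := by
  ext x k
  refine Fin.lastCases ?_ (fun k => ?_) k
  · simp only [hyperplaneMap_last, Pi.add_apply, hyperplaneLinear_last, Pi.single_eq_same]
  · simp only [hyperplaneMap_castSucc, Pi.add_apply, hyperplaneLinear_castSucc,
      Pi.single_eq_of_ne (Fin.castSucc_lt_last k).ne, add_zero]

theorem hasFDerivAt_hyperplaneMap (a : Fin 4 → ℝ) (c : ℝ) (x : Fin 4 → ℝ) :
    HasFDerivAt (hyperplaneMap a c) (hyperplaneLinear a) x := by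
  rw [hyperplaneMap_eq]
  exact (hyperplaneLinear a).hasFDerivAt.add_const _

/-- The coordinate tangent vectors of the hyperplane. -/
def hyperplaneTangent (a : Fin 4 → ℝ) (i : Fin 4) : Fin 5 → ℝ :=
  hyperplaneLinear a (Pi.single i 1)

/-- A Euclidean normal vector of the hyperplane. -/
def hyperplaneNormal (a : Fin 4 → ℝ) : Fin 5 → ℝ := Fin.snoc (α := fun _ => ℝ) a (-1)

@[simp] theorem hyperplaneNormal_castSucc (a : Fin 4 → ℝ) (k : Fin 4) :
    hyperplaneNormal a k.castSucc = a k :=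
  Fin.snoc_castSucc (α := fun _ => ℝ) ..

@[simp] theorem hyperplaneNormal_last (a : Fin 4 → ℝ) :
    hyperplaneNormal a (Fin.last 4) = -1 :=
  Fin.snoc_last (α := fun _ => ℝ) ..

theorem hyperplaneTangent_castSucc (a : Fin 4 → ℝ) (i k : Fin 4) :
    hyperplaneTangent a i k.castSucc = if k = i then 1 else 0 := by
  rw [hyperplaneTangent, hyperplaneLinear_castSucc, Pi.single_apply]

theorem hyperplaneTangent_last (a : Fin 4 → ℝ) (i : Fin 4) :
    hyperplaneTangent a i (Fin.last 4) = a i := by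
  rw [hyperplaneTangent, hyperplaneLinear_last, dotProduct_single_one]

theorem hyperplaneTangent_dotProduct (a : Fin 4 → ℝ) (i : Fin 4) (Y : Fin 5 → ℝ) :
    hyperplaneTangent a i ⬝ᵥ Y = Y i.castSucc + a i * Y (Fin.last 4) := by
  rw [dotProduct, Fin.sum_univ_castSucc]
  simp only [hyperplaneTangent_castSucc, hyperplaneTangent_last]
  simp

theorem pd_hyperplaneMap (a : Fin 4 → ℝ) (c : ℝ) (i : Fin 4) :
    pd i (hyperplaneMap a c) = fun _ => hyperplaneTangent a i := by
  ext1 x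
  rw [pd, (hasFDerivAt_hyperplaneMap a c x).fderiv, hyperplaneTangent]

theorem hyperplaneTangent_dotProduct_normal (a : Fin 4 → ℝ) (i : Fin 4) :
    hyperplaneTangent a i ⬝ᵥ hyperplaneNormal a = 0 := by
  rw [hyperplaneTangent_dotProduct, hyperplaneNormal_castSucc, hyperplaneNormal_last]; ring

/-- The first fundamental form of the hyperplane in Euclidean space. -/
def hyperplaneGram (a : Fin 4 → ℝ) : Matrix (Fin 4) (Fin 4) ℝ := 1 + Matrix.vecMulVec a a

/-- The inverse of `hyperplaneGram`. -/
def hyperplaneGramInv (a : Fin 4 → ℝ) : Matrix (Fin 4) (Fin 4) ℝ :=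
  1 - (1 + a ⬝ᵥ a)⁻¹ • Matrix.vecMulVec a a

theorem hyperplaneTangent_dotProduct_tangent (a : Fin 4 → ℝ) (i j : Fin 4) :
    hyperplaneTangent a i ⬝ᵥ hyperplaneTangent a j = hyperplaneGram a i j := by
  rw [hyperplaneTangent_dotProduct, hyperplaneTangent_castSucc, hyperplaneTangent_last]
  simp [hyperplaneGram, Matrix.one_apply, Matrix.vecMulVec_apply]

theorem one_add_dotProduct_self_pos (a : Fin n → ℝ) : 0 < 1 + a ⬝ᵥ a := by
  have := dotProduct_star_self_nonneg a
  simp only [star_trivial] at this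
  linarith

/-- The Sherman–Morrison formula for a rank-one perturbation of the identity. -/
theorem hyperplaneGram_mul_inv (a : Fin 4 → ℝ) : hyperplaneGram a * hyperplaneGramInv a = 1 := by
  have h := one_add_dotProduct_self_pos a
  ext i j
  simp only [hyperplaneGram, hyperplaneGramInv, add_mul, mul_sub, one_mul, mul_one,
    Matrix.mul_smul, Matrix.vecMulVec_mul_vecMulVec, Matrix.sub_apply, Matrix.add_apply,
    Matrix.smul_apply, Matrix.vecMulVec_apply, smul_eq_mul, Pi.smul_apply]
  field_simp
  simp

theorem hyperplaneGramInv_mulVec (a : Fin 4 → ℝ) :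
    hyperplaneGramInv a *ᵥ a = (1 + a ⬝ᵥ a)⁻¹ • a := by
  have h := one_add_dotProduct_self_pos a
  ext i
  simp [hyperplaneGramInv, Matrix.sub_mulVec, Matrix.smul_mulVec, Matrix.vecMulVec_mulVec]
  field_simp
  ring

theorem hyperplaneGram_isSymm (a : Fin 4 → ℝ) : (hyperplaneGram a).IsSymm := by
  ext i j
  simp [hyperplaneGram, Matrix.one_apply, Matrix.vecMulVec_apply, mul_comm, eq_comm]

/-! ### The induced connection and traces for the induced metric. -/

theorem inducedMetric_hyperplaneMap (A B t c : ℝ) (a : Fin 4 → ℝ) :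
    inducedMetric (conformalMetric A B t) (hyperplaneMap a c) =
      affineConformalMetric A B t a c (hyperplaneGram a) := by
  ext x i j
  simp only [inducedMetric, Matrix.of_apply, pd_hyperplaneMap, metricInner_conformalMetric,
    hyperplaneTangent_dotProduct_tangent, hyperplaneMap_last, affineConformalMetric,
    Matrix.smul_apply, smul_eq_mul]

theorem inv_inducedMetric_hyperplaneMap (A B t c : ℝ) (a x : Fin 4 → ℝ)
    (hx : 0 < A * (a ⬝ᵥ x + c) + B) :
    (inducedMetric (conformalMetric A B t) (hyperplaneMap a c) x)⁻¹ =
      (A * (a ⬝ᵥ x + c) + B) ^ (2 * t) • hyperplaneGramInv a := by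
  apply Matrix.inv_eq_right_inv
  rw [inducedMetric_hyperplaneMap, affineConformalMetric, Matrix.smul_mul, Matrix.mul_smul,
    hyperplaneGram_mul_inv, smul_smul, ← Real.rpow_add hx]
  simp

/-- Used with $y_k$ a fixed component of $X_k$ (for the tension field) or of $\nabla_k\tau$ (for the
bitension field). -/
theorem sum_christoffel_hyperplane_mul (A B t c : ℝ) (a x : Fin 4 → ℝ)
    (hx : 0 < A * (a ⬝ᵥ x + c) + B) (i j : Fin 4) (y : Fin 4 → ℝ) :
    ∑ k, christoffel (inducedMetric (conformalMetric A B t) (hyperplaneMap a c)) k i j x * y k =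
      (A * (a ⬝ᵥ x + c) + B) ^ (-1 : ℝ) * (-t * A *
        (a i * y j + a j * y i - (1 + a ⬝ᵥ a)⁻¹ * (a ⬝ᵥ y) * hyperplaneGram a i j)) := by
  simp only [inducedMetric_hyperplaneMap, christoffel_affineConformalMetric A B t a c _ _
    (hyperplaneGram_isSymm a) (hyperplaneGram_mul_inv a) x hx, hyperplaneGramInv_mulVec]
  generalize (A * (a ⬝ᵥ x + c) + B) ^ (-1 : ℝ) = u
  have h1 : a i * y j = ∑ k, (if k = j then a i else 0) * y k := by simp
  have h2 : a j * y i = ∑ k, (if k = i then a j else 0) * y k := by simp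
  rw [h1, h2]
  simp only [dotProduct, Finset.mul_sum, Finset.sum_mul, ← Finset.sum_sub_distrib,
    ← Finset.sum_add_distrib, Pi.smul_apply, smul_eq_mul]
  refine Finset.sum_congr rfl fun k _ => ?_
  ring

/-- Follows from $G^{-1}a=(1+|a|^2)^{-1}a$ and $\mathrm{tr}(G^{-1}G)=4$. The four terms are the only
shapes that occur in the tension and bitension fields. -/
theorem trace_hyperplaneGramInv (a y : Fin 4 → ℝ) (c₁ c₂ c₃ c₄ : ℝ) :
    ∑ i, ∑ j, hyperplaneGramInv a i j *
        (c₁ * (a i * a j) + c₂ * (a i * y j) + c₃ * (a j * y i) + c₄ * hyperplaneGram a i j) =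
      (1 + a ⬝ᵥ a)⁻¹ * (c₁ * (a ⬝ᵥ a) + (c₂ + c₃) * (a ⬝ᵥ y)) + 4 * c₄ := by
  have h := one_add_dotProduct_self_pos a
  have hs (i j : Fin 4) : hyperplaneGramInv a i j = hyperplaneGramInv a j i := by
    simp [hyperplaneGramInv, Matrix.one_apply, Matrix.vecMulVec_apply, mul_comm, eq_comm]
  have hv (z : Fin 4 → ℝ) : ∑ i, ∑ j, hyperplaneGramInv a i j * (z i * a j) =
      (1 + a ⬝ᵥ a)⁻¹ * (a ⬝ᵥ z) := by
    have (i : Fin 4) : ∑ j, hyperplaneGramInv a i j * (z i * a j) =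
        z i * (hyperplaneGramInv a *ᵥ a) i := by
      rw [Matrix.mulVec, dotProduct, Finset.mul_sum]
      exact Finset.sum_congr rfl fun j _ => by ring
    simp only [this, hyperplaneGramInv_mulVec, dotProduct, Finset.mul_sum, Pi.smul_apply,
      smul_eq_mul]
    exact Finset.sum_congr rfl fun i _ => by ring
  have hv' (z : Fin 4 → ℝ) : ∑ i, ∑ j, hyperplaneGramInv a i j * (a i * z j) =
      (1 + a ⬝ᵥ a)⁻¹ * (a ⬝ᵥ z) := by
    rw [← hv, Finset.sum_comm]
    exact Finset.sum_congr rfl fun i _ => Finset.sum_congr rfl fun j _ => by rw [hs]; ring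
  have h4 : ∑ i, ∑ j, hyperplaneGramInv a i j * hyperplaneGram a i j = 4 := by
    have := congrArg Matrix.trace (hyperplaneGram_mul_inv a)
    rw [Matrix.trace_one, Fintype.card_fin, Matrix.trace] at this
    simp only [Matrix.diag_apply, Matrix.mul_apply] at this
    rw [Nat.cast_ofNat] at this
    rw [← this]
    exact Finset.sum_congr rfl fun i _ => Finset.sum_congr rfl fun j _ => by rw [hs]; ring
  calc
    _ = c₁ * ∑ i, ∑ j, hyperplaneGramInv a i j * (a i * a j)
        + c₂ * ∑ i, ∑ j, hyperplaneGramInv a i j * (a i * y j)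
        + c₃ * ∑ i, ∑ j, hyperplaneGramInv a i j * (y i * a j)
        + c₄ * ∑ i, ∑ j, hyperplaneGramInv a i j * hyperplaneGram a i j := by
      simp only [Finset.mul_sum, ← Finset.sum_add_distrib]
      exact Finset.sum_congr rfl fun i _ => Finset.sum_congr rfl fun j _ => by ring
    _ = _ := by rw [hv, hv', hv, h4]; ring

/-- Reduces what survives the traces to combinations of $N$ and $e_5$. -/
theorem dotProduct_hyperplaneTangent_apply (a : Fin 4 → ℝ) (β : Fin 5) :
    (a ⬝ᵥ fun k => hyperplaneTangent a k β) =
      hyperplaneNormal a β + (1 + a ⬝ᵥ a) * (Pi.single (Fin.last 4) 1 : Fin 5 → ℝ) β := by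
  refine Fin.lastCases ?_ (fun k => ?_) β
  · simp only [hyperplaneTangent_last, hyperplaneNormal_last, Pi.single_eq_same]; ring
  · simp only [hyperplaneTangent_castSucc, hyperplaneNormal_castSucc,
      Pi.single_eq_of_ne (Fin.castSucc_lt_last k).ne]
    simp [dotProduct]

/-! ### Covariant derivatives along the hyperplane, tension and bitension. -/

/-- Fields of the form $u^rV$ with $V$ constant are closed under covariant differentiation, so the
lemma can be iterated. Equality near $x$ is enough, and is all there is: the formulas for the
iterates are established only where $u>0$. -/
theorem covDerivAlong_hyperplaneMap (A B t c r : ℝ) (a x : Fin 4 → ℝ)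
    (hx : 0 < A * (a ⬝ᵥ x + c) + B) (i : Fin 4) (V : Fin 5 → ℝ) {W : (Fin 4 → ℝ) → (Fin 5 → ℝ)}
    (hW : W =ᶠ[nhds x] fun y => (A * (a ⬝ᵥ y + c) + B) ^ r • V) :
    covDerivAlong (conformalMetric A B t) (hyperplaneMap a c) i W x =
      (A * (a ⬝ᵥ x + c) + B) ^ (r - 1) • A •
        ((r * a i) • V - t • halfSpaceForm (hyperplaneTangent a i) V) := by
  ext β
  have hpow : (A * (a ⬝ᵥ x + c) + B) ^ (r - 1) =
      (A * (a ⬝ᵥ x + c) + B) ^ (-1 : ℝ) * (A * (a ⬝ᵥ x + c) + B) ^ r := by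
    rw [← Real.rpow_add hx]; congr 1; ring
  have hsum : ∑ γ, ∑ δ, christoffel (conformalMetric A B t) β γ δ (hyperplaneMap a c x) *
      hyperplaneTangent a i γ * W x δ =
      (A * (a ⬝ᵥ x + c) + B) ^ (r - 1) * (A * (-t *
        halfSpaceForm (hyperplaneTangent a i) V β)) := by
    rw [hpow, ← sum_halfSpaceCoeff, hW.self_of_nhds]
    simp only [christoffel_conformalMetric A B t (hyperplaneMap a c x) (by rwa [hyperplaneMap_last]),
      hyperplaneMap_last]
    generalize (A * (a ⬝ᵥ x + c) + B) ^ (-1 : ℝ) = u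
    simp only [Finset.mul_sum, Pi.smul_apply, smul_eq_mul]
    exact Finset.sum_congr rfl fun γ _ => Finset.sum_congr rfl fun δ _ => by ring
  rw [covDerivAlong, pd_congr hW, pd_affine_rpow_smul _ _ _ _ _ _ _ hx]
  simp only [pd_hyperplaneMap] at hsum ⊢
  rw [hsum]
  simp only [Pi.smul_apply, Pi.sub_apply, smul_eq_mul]
  ring

theorem covDerivAlong_pd_hyperplaneMap (A B t c : ℝ) (a x : Fin 4 → ℝ)
    (hx : 0 < A * (a ⬝ᵥ x + c) + B) (i j : Fin 4) :
    covDerivAlong (conformalMetric A B t) (hyperplaneMap a c) i (pd j (hyperplaneMap a c)) x =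
      (A * (a ⬝ᵥ x + c) + B) ^ (-1 : ℝ) • (-t * A) •
        halfSpaceForm (hyperplaneTangent a i) (hyperplaneTangent a j) := by
  rw [covDerivAlong_hyperplaneMap A B t c 0 a x hx i (hyperplaneTangent a j)
    (by rw [pd_hyperplaneMap]; simp), zero_sub]
  congr 1
  module

theorem halfSpaceForm_tangent_tangent (a : Fin 4 → ℝ) (i j : Fin 4) :
    halfSpaceForm (hyperplaneTangent a i) (hyperplaneTangent a j) =
      a i • hyperplaneTangent a j + a j • hyperplaneTangent a i
        - hyperplaneGram a i j • Pi.single (Fin.last 4) 1 := by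
  rw [halfSpaceForm, hyperplaneTangent_last, hyperplaneTangent_last,
    hyperplaneTangent_dotProduct_tangent]

theorem tension_hyperplaneMap (A B t c : ℝ) (a x : Fin 4 → ℝ)
    (hx : 0 < A * (a ⬝ᵥ x + c) + B) :
    tension (inducedMetric (conformalMetric A B t) (hyperplaneMap a c)) (conformalMetric A B t)
      (hyperplaneMap a c) x =
      (A * (a ⬝ᵥ x + c) + B) ^ (2 * t - 1) •
        (-4 * t * A * (1 + a ⬝ᵥ a)⁻¹) • hyperplaneNormal a := by
  have h := one_add_dotProduct_self_pos a
  ext β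
  have hpow : (A * (a ⬝ᵥ x + c) + B) ^ (2 * t - 1) =
      (A * (a ⬝ᵥ x + c) + B) ^ (2 * t) * (A * (a ⬝ᵥ x + c) + B) ^ (-1 : ℝ) := by
    rw [← Real.rpow_add hx]; congr 1
  -- Only the $G_{ij}$ term remains: the terms $a_iX_j+a_jX_i$ cancel against those of the induced
  -- connection, so the second fundamental form is proportional to the metric.
  have hT := trace_hyperplaneGramInv a 0 0 0 0
    ((1 + a ⬝ᵥ a)⁻¹ * (a ⬝ᵥ fun k => hyperplaneTangent a k β)
      - (Pi.single (Fin.last 4) 1 : Fin 5 → ℝ) β)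
  simp only [tension, Finset.sum_apply, Pi.smul_apply, Pi.sub_apply, smul_eq_mul,
    pd_hyperplaneMap a c, sum_christoffel_hyperplane_mul A B t c a x hx _ _
      fun k => hyperplaneTangent a k β]
  simp only [← pd_hyperplaneMap a c, covDerivAlong_pd_hyperplaneMap A B t c a x hx,
    inv_inducedMetric_hyperplaneMap A B t c a x hx, halfSpaceForm_tangent_tangent]
  simp only [Matrix.smul_apply, Pi.smul_apply, Pi.sub_apply, Pi.add_apply, smul_eq_mul, hpow]
  generalize (A * (a ⬝ᵥ x + c) + B) ^ (-1 : ℝ) = u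
  generalize (A * (a ⬝ᵥ x + c) + B) ^ (2 * t) = v
  trans v * u * (-t * A) * (4 * ((1 + a ⬝ᵥ a)⁻¹ * (a ⬝ᵥ fun k => hyperplaneTangent a k β)
      - (Pi.single (Fin.last 4) 1 : Fin 5 → ℝ) β))
  · simp only [zero_mul, zero_add, mul_zero, add_zero, dotProduct_zero] at hT
    rw [← hT]
    simp only [Finset.mul_sum]
    exact Finset.sum_congr rfl fun i _ => Finset.sum_congr rfl fun j _ => by ring
  · rw [dotProduct_hyperplaneTangent_apply]
    field_simp
    ring

theorem covDerivAlong_tension_hyperplaneMap (A B t c : ℝ) (a x : Fin 4 → ℝ)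
    (hx : 0 < A * (a ⬝ᵥ x + c) + B) (j : Fin 4) :
    covDerivAlong (conformalMetric A B t) (hyperplaneMap a c) j
      (tension (inducedMetric (conformalMetric A B t) (hyperplaneMap a c)) (conformalMetric A B t)
        (hyperplaneMap a c)) x =
      (A * (a ⬝ᵥ x + c) + B) ^ (2 * t - 2) • (A * (-4 * t * A * (1 + a ⬝ᵥ a)⁻¹)) •
        (((t - 1) * a j) • hyperplaneNormal a + t • hyperplaneTangent a j) := by
  rw [covDerivAlong_hyperplaneMap A B t c (2 * t - 1) a x hx j _
    (Filter.eventually_of_mem ((isOpen_affine_pos A B c a).mem_nhds hx)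
      fun y hy => tension_hyperplaneMap A B t c a y hy)]
  rw [show 2 * t - 1 - 1 = 2 * t - 2 by ring]
  simp only [halfSpaceForm, hyperplaneTangent_last, hyperplaneNormal_last, dotProduct_smul,
    hyperplaneTangent_dotProduct_normal, Pi.smul_apply, smul_eq_mul]
  module

theorem covDerivAlong_covDerivAlong_tension_hyperplaneMap (A B t c : ℝ) (a x : Fin 4 → ℝ)
    (hx : 0 < A * (a ⬝ᵥ x + c) + B) (i j : Fin 4) :
    covDerivAlong (conformalMetric A B t) (hyperplaneMap a c) i
      (covDerivAlong (conformalMetric A B t) (hyperplaneMap a c) j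
        (tension (inducedMetric (conformalMetric A B t) (hyperplaneMap a c))
          (conformalMetric A B t) (hyperplaneMap a c))) x =
      (A * (a ⬝ᵥ x + c) + B) ^ (2 * t - 3) • (A ^ 2 * (-4 * t * A * (1 + a ⬝ᵥ a)⁻¹)) •
        (((t - 2) * a i) • (((t - 1) * a j) • hyperplaneNormal a + t • hyperplaneTangent a j)
          - (t * a j) • hyperplaneTangent a i
          + (t ^ 2 * hyperplaneGram a i j) • Pi.single (Fin.last 4) 1) := by
  rw [covDerivAlong_hyperplaneMap A B t c (2 * t - 2) a x hx i _
    (Filter.eventually_of_mem ((isOpen_affine_pos A B c a).mem_nhds hx)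
      fun y hy => covDerivAlong_tension_hyperplaneMap A B t c a y hy j)]
  rw [show 2 * t - 2 - 1 = 2 * t - 3 by ring]
  simp only [halfSpaceForm, hyperplaneTangent_last, hyperplaneNormal_last, dotProduct_smul,
    hyperplaneTangent_dotProduct_normal, Pi.smul_apply, Pi.add_apply, smul_eq_mul, dotProduct_add,
    hyperplaneTangent_dotProduct_tangent]
  module

theorem curvature_tension_hyperplaneMap (A B t c : ℝ) (a x : Fin 4 → ℝ)
    (hx : 0 < A * (a ⬝ᵥ x + c) + B) (i j : Fin 4) :
    curvature (conformalMetric A B t) (hyperplaneMap a c x) (hyperplaneTangent a i)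
      (tension (inducedMetric (conformalMetric A B t) (hyperplaneMap a c))
        (conformalMetric A B t) (hyperplaneMap a c) x) (hyperplaneTangent a j) =
      (A * (a ⬝ᵥ x + c) + B) ^ (2 * t - 3) • (A ^ 2 * (-4 * t * A * (1 + a ⬝ᵥ a)⁻¹)) •
        ((t ^ 2 * hyperplaneGram a i j) • hyperplaneNormal a
          + (t * (1 - t)) • ((a i * a j) • hyperplaneNormal a + a j • hyperplaneTangent a i
            - hyperplaneGram a i j • Pi.single (Fin.last 4) 1)) := by
  have hpow : (A * (a ⬝ᵥ x + c) + B) ^ (2 * t - 3) =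
      (A * (a ⬝ᵥ x + c) + B) ^ (-2 : ℝ) * (A * (a ⬝ᵥ x + c) + B) ^ (2 * t - 1) := by
    rw [← Real.rpow_add hx]; congr 1; ring
  have hNX : hyperplaneNormal a ⬝ᵥ hyperplaneTangent a j = 0 := by
    rw [dotProduct_comm, hyperplaneTangent_dotProduct_normal]
  have hNe : hyperplaneNormal a ⬝ᵥ Pi.single (Fin.last 4) 1 = -1 := by
    rw [dotProduct_single_one, hyperplaneNormal_last]
  have hXe : hyperplaneTangent a i ⬝ᵥ Pi.single (Fin.last 4) 1 = a i := by
    rw [dotProduct_single_one, hyperplaneTangent_last]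
  rw [curvature_conformalMetric A B t _ (by rwa [hyperplaneMap_last]),
    tension_hyperplaneMap A B t c a x hx, hyperplaneMap_last, hpow]
  generalize (A * (a ⬝ᵥ x + c) + B) ^ (-2 : ℝ) = u
  generalize (A * (a ⬝ᵥ x + c) + B) ^ (2 * t - 1) = v
  have hNX' : hyperplaneNormal a ⬝ᵥ hyperplaneTangent a i = 0 := by
    rw [dotProduct_comm, hyperplaneTangent_dotProduct_normal]
  simp only [halfSpaceForm, hyperplaneTangent_last, hyperplaneNormal_last, dotProduct_smul,
    smul_dotProduct, hNX, hNX', hNe, hXe, hyperplaneTangent_dotProduct_normal, Pi.smul_apply,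
    Pi.add_apply, Pi.sub_apply, Pi.single_eq_same, smul_eq_mul, dotProduct_add, dotProduct_sub,
    hyperplaneTangent_dotProduct_tangent]
  module

theorem bitension_hyperplaneMap_eq_zero (A B t c : ℝ) (a x : Fin 4 → ℝ)
    (hx : 0 < A * (a ⬝ᵥ x + c) + B) (ha : (a ⬝ᵥ a) * (1 - 2 * t) = 2 * t) :
    bitension (inducedMetric (conformalMetric A B t) (hyperplaneMap a c)) (conformalMetric A B t)
      (hyperplaneMap a c) x = 0 := by
  have h := one_add_dotProduct_self_pos a
  ext β
  have hpow : (A * (a ⬝ᵥ x + c) + B) ^ (2 * t - 3) =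
      (A * (a ⬝ᵥ x + c) + B) ^ (-1 : ℝ) * (A * (a ⬝ᵥ x + c) + B) ^ (2 * t - 2) := by
    rw [← Real.rpow_add hx]; congr 1; ring
  simp only [bitension, Finset.sum_apply, Pi.smul_apply, Pi.sub_apply, smul_eq_mul,
    pd_hyperplaneMap a c, curvature_tension_hyperplaneMap A B t c a x hx,
    sum_christoffel_hyperplane_mul A B t c a x hx _ _ fun k =>
      covDerivAlong (conformalMetric A B t) (hyperplaneMap a c) k
        (tension (inducedMetric (conformalMetric A B t) (hyperplaneMap a c))
            (conformalMetric A B t) (hyperplaneMap a c)) x β]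
  simp only [covDerivAlong_covDerivAlong_tension_hyperplaneMap A B t c a x hx,
    covDerivAlong_tension_hyperplaneMap A B t c a x hx,
    inv_inducedMetric_hyperplaneMap A B t c a x hx]
  simp only [Matrix.smul_apply, Pi.smul_apply, Pi.sub_apply, Pi.add_apply, smul_eq_mul, hpow,
    Pi.zero_apply]
  have hdot (p q r s : ℝ) : (a ⬝ᵥ fun k => p * (q * (r * a k * hyperplaneNormal a β
      + s * hyperplaneTangent a k β))) = p * (q * (r * (a ⬝ᵥ a) * hyperplaneNormal a β
      + s * (a ⬝ᵥ fun k => hyperplaneTangent a k β))) := by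
    simp only [dotProduct, Finset.mul_sum, Finset.sum_mul, ← Finset.sum_add_distrib]
    exact Finset.sum_congr rfl fun k _ => by ring
  simp only [hdot]
  -- Coefficients of $a_ia_j$, $a_iX_j$, $a_jX_i$ and $G_{ij}$, each collected from the second
  -- derivative, the induced connection term and the curvature term.
  have hT := trace_hyperplaneGramInv a (fun k => hyperplaneTangent a k β)
    (((t - 2) * (t - 1) + 2 * t * (t - 1) - t * (1 - t)) * hyperplaneNormal a β)
    ((t - 2) * t + t ^ 2)
    (- t + t ^ 2 - t * (1 - t))
    (t ^ 2 * (Pi.single (Fin.last 4) 1 : Fin 5 → ℝ) β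
      - t * (1 + a ⬝ᵥ a)⁻¹ * ((t - 1) * (a ⬝ᵥ a) * hyperplaneNormal a β
        + t * (a ⬝ᵥ fun k => hyperplaneTangent a k β))
      - t ^ 2 * hyperplaneNormal a β
      + t * (1 - t) * (Pi.single (Fin.last 4) 1 : Fin 5 → ℝ) β)
  generalize (A * (a ⬝ᵥ x + c) + B) ^ (-1 : ℝ) = u
  generalize (A * (a ⬝ᵥ x + c) + B) ^ (2 * t) = v
  generalize (A * (a ⬝ᵥ x + c) + B) ^ (2 * t - 2) = w
  refine Eq.trans ?_ (mul_zero (v * u * w * A ^ 2 * (-4 * t * A * (1 + a ⬝ᵥ a)⁻¹)))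
  refine Eq.trans ?_ (congrArg _ (hT.trans ?_))
  · simp only [Finset.mul_sum]
    exact Finset.sum_congr rfl fun i _ => Finset.sum_congr rfl fun j _ => by ring
  · rw [dotProduct_hyperplaneTangent_apply]
    field_simp
    -- The $e_5$ terms cancel; after clearing $1+|a|^2$, what is left is
    -- $2(1+t)\big(|a|^2(1-2t)-2t\big)N$.
    linear_combination (2 * (1 + t) * hyperplaneNormal a β) * ha

/-! ### The embedding and its image. -/

theorem parametrizesSubmanifold_hyperplaneMap (a : Fin 4 → ℝ) (c : ℝ) :
    ParametrizesSubmanifold (hyperplaneDomain a c) upperHalfSpace5 (hyperplaneMap a c) where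
  isOpen := isOpen_lt continuous_const (by fun_prop)
  mapsTo x hx := by
    rw [upperHalfSpace5, Set.mem_ofPred_eq, hyperplaneMap_last]
    exact hx
  smooth := by
    rw [hyperplaneMap_eq]
    exact ((hyperplaneLinear a).contDiff.add contDiff_const).contDiffOn
  immersion x _ := by
    rw [(hasFDerivAt_hyperplaneMap a c x).fderiv]
    intro v w hvw
    ext k
    simpa only [hyperplaneLinear_castSucc] using congrFun hvw k.castSucc
  embedding := by
    have hcont : Continuous (hyperplaneMap a c) := by
      rw [hyperplaneMap_eq]; fun_prop
    have hinv : Function.LeftInverse (fun (p : Fin 5 → ℝ) (k : Fin 4) => p k.castSucc)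
        (hyperplaneMap a c) := fun x => by ext k; exact hyperplaneMap_castSucc a x c k
    exact (hinv.isEmbedding (by fun_prop) hcont).comp Topology.IsEmbedding.subtypeVal

theorem image_hyperplaneMap (a : Fin 4 → ℝ) (c : ℝ) :
    hyperplaneMap a c '' hyperplaneDomain a c = hyperplane a c := by
  ext p
  constructor
  · rintro ⟨x, hx, rfl⟩
    refine ⟨(parametrizesSubmanifold_hyperplaneMap a c).mapsTo hx, ?_⟩
    simp only [hyperplaneMap_last, hyperplaneMap_castSucc, dotProduct]
  · rintro ⟨hp, hz⟩
    refine ⟨fun k => p k.castSucc, ?_, ?_⟩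
    · rw [hyperplaneDomain, Set.mem_ofPred_eq, ← hz]
      exact hp
    · ext k
      refine Fin.lastCases ?_ (fun k => ?_) k
      · rw [hyperplaneMap_last, hz]; rfl
      · rw [hyperplaneMap_castSucc]

/-! ### Neither minimal nor harmonic. -/

/-- A hyperplane that is not horizontal meets every level. -/
theorem exists_dotProduct_add_eq {a : Fin n → ℝ} (ha : a ⬝ᵥ a ≠ 0) (c z : ℝ) :
    ∃ x, a ⬝ᵥ x + c = z :=
  ⟨((z - c) / (a ⬝ᵥ a)) • a, by rw [dotProduct_smul, smul_eq_mul]; field_simp; ring⟩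

theorem not_isMinimalOn_hyperplaneMap {A B t : ℝ} (hA : 0 < A) (hB : 0 < B) (ht : 0 < t)
    (c : ℝ) {a : Fin 4 → ℝ} (ha : a ⬝ᵥ a ≠ 0) :
    ¬ IsMinimalOn (hyperplaneDomain a c) (conformalMetric A B t) (hyperplaneMap a c) := by
  intro hmin
  -- Any positive height would do. The condition $a\neq0$ ensures that the domain is nonempty
  -- whatever the sign of $c$; on an empty domain minimality would hold vacuously.
  obtain ⟨x, hx1⟩ := exists_dotProduct_add_eq ha c 1
  have hx : 0 < A * (a ⬝ᵥ x + c) + B := by rw [hx1]; positivity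
  have hmem : x ∈ hyperplaneDomain a c := by
    have : 0 < a ⬝ᵥ x + c := by rw [hx1]; exact one_pos
    exact this
  have key := hmin x hmem (hyperplaneNormal a) fun k => by
    rw [pd_hyperplaneMap, metricInner_conformalMetric, hyperplaneTangent_dotProduct_normal,
      mul_zero]
  -- Against $N$ the form $S$ restricts to $G$, whose $G^{-1}$-trace is $4$, so the mean curvature
  -- has a strict sign.
  have hII (i j : Fin 4) : halfSpaceForm (hyperplaneTangent a i) (hyperplaneTangent a j) ⬝ᵥ
      hyperplaneNormal a = hyperplaneGram a i j := by
    rw [halfSpaceForm_dotProduct, hyperplaneTangent_dotProduct_normal,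
      hyperplaneTangent_dotProduct_normal, hyperplaneNormal_last,
      hyperplaneTangent_dotProduct_tangent]
    ring
  simp only [covDerivAlong_pd_hyperplaneMap A B t c a x hx, metricInner_conformalMetric,
    inv_inducedMetric_hyperplaneMap A B t c a x hx, smul_dotProduct, hII, hyperplaneMap_last,
    Matrix.smul_apply, smul_eq_mul] at key
  have hT := trace_hyperplaneGramInv a 0 0 0 0 1
  simp only [zero_mul, zero_add, mul_zero, add_zero, dotProduct_zero, one_mul, mul_one] at hT
  have h1 := Real.rpow_pos_of_pos hx (-1)
  have h2 := Real.rpow_pos_of_pos hx (2 * t)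
  have h3 := Real.rpow_pos_of_pos hx (-2 * t)
  generalize (A * (a ⬝ᵥ x + c) + B) ^ (-1 : ℝ) = u at *
  generalize (A * (a ⬝ᵥ x + c) + B) ^ (2 * t) = v at *
  generalize (A * (a ⬝ᵥ x + c) + B) ^ (-2 * t) = w at *
  have hval : v * w * u * (-t * A) * 4 = 0 := by
    rw [← key, ← hT, Finset.mul_sum]
    refine Finset.sum_congr rfl fun i _ => ?_
    rw [Finset.mul_sum]
    exact Finset.sum_congr rfl fun j _ => by ring
  have : 0 < v * w * u * (t * A) * 4 := by positivity
  linarith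

theorem not_isHarmonicOn_hyperplaneMap {A B t : ℝ} (hA : 0 < A) (hB : 0 < B) (ht : 0 < t)
    (c : ℝ) {a : Fin 4 → ℝ} (ha : a ⬝ᵥ a ≠ 0) :
    ¬ IsHarmonicOn (hyperplaneDomain a c)
      (inducedMetric (conformalMetric A B t) (hyperplaneMap a c))
      (conformalMetric A B t) (hyperplaneMap a c) := by
  intro hharm
  obtain ⟨x, hx1⟩ := exists_dotProduct_add_eq ha c 1
  have hx : 0 < A * (a ⬝ᵥ x + c) + B := by rw [hx1]; positivity
  have hmem : x ∈ hyperplaneDomain a c := by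
    have : 0 < a ⬝ᵥ x + c := by rw [hx1]; exact one_pos
    exact this
  have key := congrFun (hharm x hmem) (Fin.last 4)
  rw [tension_hyperplaneMap A B t c a x hx] at key
  simp only [Pi.smul_apply, hyperplaneNormal_last, smul_eq_mul, Pi.zero_apply] at key
  have h1 := Real.rpow_pos_of_pos hx (2 * t - 1)
  have h := one_add_dotProduct_self_pos a
  generalize (A * (a ⬝ᵥ x + c) + B) ^ (2 * t - 1) = u at *
  have : 0 < u * (4 * t * A * (1 + a ⬝ᵥ a)⁻¹) := by positivity
  linarith

theorem dotProduct_self_of_sum_sq {t : ℝ} {a : Fin 4 → ℝ}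
    (ha : ∑ i, a i ^ 2 = 2 * t / (1 - 2 * t)) : a ⬝ᵥ a = 2 * t / (1 - 2 * t) := by
  rw [← ha]
  exact Finset.sum_congr rfl fun i _ => (sq (a i)).symm

/-! ### Counterexamples and their infinite families. -/

theorem isProperBiharmonicSubmanifold_hyperplaneMap {A B t : ℝ} (hA : 0 < A) (hB : 0 < B)
    (ht : 0 < t) (ht2 : t < 1 / 2) (c : ℝ) {a : Fin 4 → ℝ}
    (ha : a ⬝ᵥ a = 2 * t / (1 - 2 * t)) :
    IsProperBiharmonicSubmanifold (hyperplaneDomain a c) upperHalfSpace5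
      (conformalMetric A B t) (hyperplaneMap a c) where
  submanifold := parametrizesSubmanifold_hyperplaneMap a c
  biharmonic x hx := by
    have h : 0 < a ⬝ᵥ x + c := hx
    refine bitension_hyperplaneMap_eq_zero A B t c a x (by positivity) ?_
    rw [ha]
    exact div_mul_cancel₀ _ (by linarith)
  not_minimal := not_isMinimalOn_hyperplaneMap hA hB ht c <| by
    rw [ha]
    exact (div_pos (by linarith) (by linarith)).ne'

theorem isChenCounterexample_hyperplaneMap {A B t : ℝ} (hA : 0 < A) (hB : 0 < B)
    (ht : 0 < t) (ht2 : t < 1 / 2) (c : ℝ) {a : Fin 4 → ℝ}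
    (ha : a ⬝ᵥ a = 2 * t / (1 - 2 * t)) :
    IsChenCounterexample (hyperplaneDomain a c) upperHalfSpace5
      (conformalMetric A B t) (hyperplaneMap a c) where
  metric := isRiemannianMetricOn_conformalMetric hA hB t
  nonpos p hp X Y hXY :=
    (hasNegSectionalCurvatureOn_conformalMetric hA hB ht (by linarith) p hp X Y hXY).le
  proper_biharmonic := isProperBiharmonicSubmanifold_hyperplaneMap hA hB ht ht2 c ha

theorem exists_sum_sq_eq {s : ℝ} (hs : 0 ≤ s) : ∃ a : Fin 4 → ℝ, ∑ i, a i ^ 2 = s :=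
  ⟨Pi.single 0 (Real.sqrt s), by
    rw [Finset.sum_eq_single 0 (fun i _ hi => by simp [Pi.single_eq_of_ne hi]) (by simp)]
    rw [Pi.single_eq_same, Real.sq_sqrt hs]⟩

/-- With $a\neq0$ fixed, a point at height $1$ on the hyperplane determines $c$; different constants
thus give different submanifolds. -/
theorem hyperplane_injective {a : Fin 4 → ℝ} (ha : a ⬝ᵥ a ≠ 0) :
    Function.Injective (hyperplane a) := by
  intro c c' hcc
  obtain ⟨x, hx⟩ := exists_dotProduct_add_eq ha c 1
  have hmem : x ∈ hyperplaneDomain a c := by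
    have : 0 < a ⬝ᵥ x + c := by rw [hx]; exact one_pos
    exact this
  have h : hyperplaneMap a c x ∈ hyperplane a c := by
    rw [← image_hyperplaneMap]; exact ⟨x, hmem, rfl⟩
  rw [hcc] at h
  have h2 := h.2
  simp only [hyperplaneMap_last, hyperplaneMap_castSucc] at h2
  exact add_left_cancel h2

theorem conformalMetric_domRestrict_injective {A B : ℝ} (hA : 0 < A) (hB : 0 < B) :
    Function.Injective fun t => upperHalfSpace5.domRestrict (conformalMetric A B t) := by
  intro t t' htt
  -- At height $1/A$ the base of the power is $1+B>1$, so the conformal factor determines the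
  -- exponent.
  have hp : (fun _ => 1 / A : Fin 5 → ℝ) ∈ upperHalfSpace5 := by
    rw [upperHalfSpace5, Set.mem_ofPred_eq]; positivity
  have h := congrFun (congrFun (congrFun htt ⟨_, hp⟩) 0) 0
  simp only [Set.domRestrict_apply, conformalMetric, Matrix.smul_apply, Matrix.one_apply_eq,
    smul_eq_mul, mul_one, mul_one_div_cancel hA.ne'] at h
  have := (Real.rpow_right_inj (by linarith) (by linarith)).mp h
  linarith

end ChartGeom

end

open ChartGeom in
theorem theorem3p3 :
    (∀ A B t c : ℝ, ∀ a : Fin 4 → ℝ, 0 < A → 0 < B → 0 < t → t < 1 / 2 →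
      ∑ i, a i ^ 2 = 2 * t / (1 - 2 * t) →
        IsRiemannianMetricOn upperHalfSpace5 (conformalMetric A B t) ∧
        HasNegSectionalCurvatureOn upperHalfSpace5 (conformalMetric A B t) ∧
        hyperplaneMap a c '' hyperplaneDomain a c = hyperplane a c ∧
        IsProperBiharmonicSubmanifold (hyperplaneDomain a c) upperHalfSpace5
          (conformalMetric A B t) (hyperplaneMap a c) ∧
        ¬ IsHarmonicOn (hyperplaneDomain a c)
          (inducedMetric (conformalMetric A B t) (hyperplaneMap a c))
          (conformalMetric A B t) (hyperplaneMap a c)) ∧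
    -- in each of these spaces, infinitely many of the hyperplanes are counterexamples
    (∀ A B t : ℝ, 0 < A → 0 < B → 0 < t → t < 1 / 2 →
      {S : Set (Fin 5 → ℝ) | ∃ (a : Fin 4 → ℝ) (c : ℝ),
        ∑ i, a i ^ 2 = 2 * t / (1 - 2 * t) ∧ S = hyperplane a c ∧
        IsChenCounterexample (hyperplaneDomain a c) upperHalfSpace5
          (conformalMetric A B t) (hyperplaneMap a c)}.Infinite) ∧
    -- for all `A`, `B`, infinitely many metrics on the half space admit such counterexamples
    (∀ A B : ℝ, 0 < A → 0 < B →
      {k : upperHalfSpace5 → Matrix (Fin 5) (Fin 5) ℝ | ∃ (t c : ℝ) (a : Fin 4 → ℝ),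
        0 < t ∧ t < 1 / 2 ∧ ∑ i, a i ^ 2 = 2 * t / (1 - 2 * t) ∧
        k = upperHalfSpace5.domRestrict (conformalMetric A B t) ∧
        IsChenCounterexample (hyperplaneDomain a c) upperHalfSpace5
          (conformalMetric A B t) (hyperplaneMap a c)}.Infinite) := by
  have hpos {t : ℝ} (ht : 0 < t) (ht2 : t < 1 / 2) : 0 < 2 * t / (1 - 2 * t) :=
    div_pos (by linarith) (by linarith)
  refine ⟨fun A B t c a hA hB ht ht2 ha => ?_, fun A B t hA hB ht ht2 => ?_, fun A B hA hB => ?_⟩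
  · have ha' := dotProduct_self_of_sum_sq ha
    exact ⟨isRiemannianMetricOn_conformalMetric hA hB t,
      hasNegSectionalCurvatureOn_conformalMetric hA hB ht (by linarith),
      image_hyperplaneMap a c, isProperBiharmonicSubmanifold_hyperplaneMap hA hB ht ht2 c ha',
      not_isHarmonicOn_hyperplaneMap hA hB ht c (by rw [ha']; exact (hpos ht ht2).ne')⟩
  · obtain ⟨a, ha⟩ := exists_sum_sq_eq (hpos ht ht2).le
    have ha' := dotProduct_self_of_sum_sq ha
    exact Set.infinite_of_injective_forall_mem
      (hyperplane_injective (by rw [ha']; exact (hpos ht ht2).ne')) fun c =>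
        ⟨a, c, ha, rfl, isChenCounterexample_hyperplaneMap hA hB ht ht2 c ha'⟩
  · refine ((Set.Ioo_infinite (show (0 : ℝ) < 1 / 2 by norm_num)).image
      (conformalMetric_domRestrict_injective hA hB).injOn).mono ?_
    rintro _ ⟨t, ⟨ht, ht2⟩, rfl⟩
    obtain ⟨a, ha⟩ := exists_sum_sq_eq (hpos ht ht2).le
    exact ⟨t, 0, a, ht, ht2, ha, rfl,
      isChenCounterexample_hyperplaneMap hA hB ht ht2 0 (dotProduct_self_of_sum_sq ha)⟩
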